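/- Notation. Let $\mathbb D$ be the open unit disc and $H^\infty$ the algebra of bounded holomorphic functions on $\mathbb D$. For $\lambda\in\mathbb D$ put $b_\lambda(z)=\frac{z-\lambda}{1-\overline\lambda z}$. For a completely non-unitary contraction $T$ on a complex Hilbert space $\mathcal H$ and $u\in H^\infty$ with $u(z)=\sum_n a_nz^n$, let $u(T)$ be given by the Sz.-Nagy–Foias functional calculus, i.e. $u(T)$ is the strong limit of $\sum_n r^na_nT^n$ as $r\uparrow 1$, and let $H^\infty(T)=\{u(T):u\in H^\infty\}\subset B(\mathcal H)$, with the operator norm. $T$ is of class $C_0$ if it is a completely non-unitary contraction and $u(T)=0$ for some nonzero $u\in H^\infty$; an inner function $\theta$ is the minimal function of $T$ if $\{u\in H^\infty:u(T)=0\}=\theta H^\infty$; $T$ is multiplicity-free if it has a cyclic vector. For an inner function $\theta$ let $H(\theta)=H^2\ominus\theta H^2$, and let $S(\theta)$ be the operator on $H(\theta)$ with $S(\theta)^*=S^*|_{H(\theta)}$, where $S$ is the shift on the Hardy space $H^2$. Statement. There is a function $C:\mathbb R\times\mathbb N\to(0,\infty)$ with the following property. Let $N\ge 2$, let $\lambda_1,\dots,\lambda_N\in\mathbb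 D$ (not necessarily distinct), and let $T\in B(\mathcal H)$ be a multiplicity-free operator of class $C_0$ with minimal function $\theta=b_{\lambda_1}\cdots b_{\lambda_N}$. Put $$\eta=\sup_{1\le j,k\le N}\frac{|b_{\lambda_j}(\lambda_k)|^{1/2}}{(1-\max\{|\lambda_j|,|\lambda_k|\}^2)^{1/2}}.$$ Let $\Psi:H^\infty(T)\to H^\infty(S(\theta))$ be a bounded linear map such that $\Psi(u(T))=u(S(\theta))$ for every $u\in H^\infty$, and suppose that $\beta=1/\|\Psi\|-5\sqrt2\,\eta$ satisfies $$\sqrt{1-\frac1{(N-1)^2}}<\beta<1.$$ Then there is a bounded invertible operator $X:\mathcal H\to H(\theta)$ with bounded inverse such that $XT=S(\theta)X$ and $$\max\{\|X\|,\|X^{-1}\|\}\le C(\|\Psi\|,N).$$ -/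

import Mathlib

open scoped Topology ComplexConjugate BoundedContinuousFunction Complex.UnitDisc

namespace CZero

noncomputable section

/-! ### The algebra of bounded holomorphic functions on the unit disc -/

/-- Extension by zero to the plane of a function on the open unit disc. -/
def ext (f : 𝔻 → ℂ) (z : ℂ) : ℂ :=
  if h : ‖z‖ < 1 then f (Complex.UnitDisc.mk z h) else 0

lemma ext_coe (f : 𝔻 → ℂ) (z : 𝔻) : ext f (z : ℂ) = f z := by
  unfold ext
  rw [dif_pos z.norm_lt_one, Complex.UnitDisc.mk_coe]

/-- The bounded holomorphic functions on the open unit disc, as an algebra with the supremum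
norm. -/
def hInfSubalgebra : Subalgebra ℂ (𝔻 →ᵇ ℂ) where
  carrier := {u | DifferentiableOn ℂ (ext u) (Metric.ball 0 1)}
  mul_mem' {u v} hu hv := by
    refine (DifferentiableOn.mul hu hv).congr fun z hz => ?_
    have hz' : ‖z‖ < 1 := by simpa using hz
    simp [ext, hz']
  add_mem' {u v} hu hv := by
    refine (DifferentiableOn.add hu hv).congr fun z hz => ?_
    have hz' : ‖z‖ < 1 := by simpa using hz
    simp [ext, hz']
  algebraMap_mem' c := by
    refine (differentiableOn_const (c := c)).congr fun z hz => ?_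
    have hz' : ‖z‖ < 1 := by simpa using hz
    simp [ext, hz']

/-- The algebra `H^∞`. -/
abbrev HInf : Type := hInfSubalgebra

/-- The value of a bounded holomorphic function at a point of the disc. -/
def HInf.eval (u : HInf) (z : 𝔻) : ℂ := (u : 𝔻 →ᵇ ℂ) z

/-- The `n`-th Taylor coefficient at the origin. -/
def HInf.coeff (u : HInf) (n : ℕ) : ℂ :=
  iteratedDeriv n (ext u.eval) 0 / (n.factorial : ℂ)

/-- Inner functions: the radial boundary values have modulus one almost everywhere. -/
def IsInner (u : HInf) : Prop :=
  ∀ᵐ t : ℝ, Filter.Tendsto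
    (fun r : ℝ => ‖ext u.eval ((r : ℂ) * Complex.exp ((t : ℂ) * Complex.I))‖) (𝓝[<] 1) (𝓝 1)

lemma HInf.differentiableOn (u : HInf) : DifferentiableOn ℂ (ext u.eval) (Metric.ball 0 1) := u.2

lemma HInf.contDiffAt (u : HInf) (n : ℕ) : ContDiffAt ℂ n (ext u.eval) 0 :=
  (u.differentiableOn.contDiffOn Metric.isOpen_ball).contDiffAt
    (Metric.isOpen_ball.mem_nhds (by simp))

lemma HInf.summable_norm_coeff (u : HInf) {r : ℝ} (h0 : 0 ≤ r) (h1 : r < 1) :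
    Summable fun n => ‖(r : ℂ) ^ n * u.coeff n‖ := by
  have hz : (r : ℂ) ∈ Metric.ball (0 : ℂ) 1 := by simpa [abs_of_nonneg h0] using h1
  have h := (Complex.hasSum_taylorSeries_on_ball u.differentiableOn hz).summable.norm
  refine h.congr fun n => ?_
  congr 1
  simp only [HInf.coeff, smul_eq_mul, sub_zero]
  ring

lemma HInf.coeff_add (u v : HInf) (n : ℕ) : (u + v).coeff n = u.coeff n + v.coeff n := by
  have h : ext (u + v).eval = ext u.eval + ext v.eval := by
    funext z
    by_cases hz : ‖z‖ < 1 <;> simp [ext, hz, HInf.eval]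
  rw [HInf.coeff, h, iteratedDeriv_add (u.contDiffAt n) (v.contDiffAt n), add_div]
  rfl

lemma HInf.coeff_mul (u v : HInf) (n : ℕ) :
    (u * v).coeff n = ∑ k ∈ Finset.range (n + 1), u.coeff k * v.coeff (n - k) := by
  have h : ext (u * v).eval = ext u.eval * ext v.eval := by
    funext z
    by_cases hz : ‖z‖ < 1 <;> simp [ext, hz, HInf.eval]
  rw [HInf.coeff, h, iteratedDeriv_mul (u.contDiffAt n) (v.contDiffAt n), Finset.sum_div]
  refine Finset.sum_congr rfl fun k hk => ?_
  have hk' : k ≤ n := Nat.lt_succ_iff.mp (Finset.mem_range.mp hk)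
  have hc : (n.choose k : ℂ) * (k.factorial : ℂ) * ((n - k).factorial : ℂ) = n.factorial := by
    exact_mod_cast Nat.choose_mul_factorial_mul_factorial hk'
  have h1 : (k.factorial : ℂ) ≠ 0 := by exact_mod_cast k.factorial_ne_zero
  have h2 : ((n - k).factorial : ℂ) ≠ 0 := by exact_mod_cast (n - k).factorial_ne_zero
  have h3 : (n.choose k : ℂ) ≠ 0 := by exact_mod_cast (Nat.choose_pos hk').ne'
  unfold HInf.coeff
  rw [← hc]
  field_simp

lemma HInf.coeff_algebraMap (c : ℂ) (n : ℕ) :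
    (algebraMap ℂ HInf c).coeff n = if n = 0 then c else 0 := by
  have h : ext (algebraMap ℂ HInf c).eval =ᶠ[𝓝 0] fun _ => c := by
    filter_upwards [Metric.isOpen_ball.mem_nhds (Metric.mem_ball_self (x := (0 : ℂ)) one_pos)]
      with z hz
    have hz' : ‖z‖ < 1 := by simpa using hz
    simp [ext, hz', HInf.eval]
  rw [HInf.coeff, h.iteratedDeriv_eq n, iteratedDeriv_const]
  rcases n with _ | n <;> simp

/-! ### Finite Blaschke products -/

/-- The Blaschke factor `b_λ(z) = (z - λ) / (1 - conj λ * z)` as a function on the disc. -/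
def blaschkeFun (a z : 𝔻) : ℂ := ((z : ℂ) - a) / (1 - conj (a : ℂ) * z)

lemma one_sub_conj_mul_ne_zero (a z : 𝔻) : 1 - conj (a : ℂ) * (z : ℂ) ≠ 0 := by
  intro h
  have h1 : ‖conj (a : ℂ) * (z : ℂ)‖ = 1 := by rw [← sub_eq_zero.mp h]; simp
  rw [norm_mul, Complex.norm_conj] at h1
  nlinarith [a.norm_lt_one, z.norm_lt_one, norm_nonneg (a : ℂ), norm_nonneg (z : ℂ)]

lemma norm_blaschkeFun_le (a z : 𝔻) : ‖blaschkeFun a z‖ ≤ 1 := by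
  rw [blaschkeFun, norm_div, div_le_one (norm_pos_iff.mpr (one_sub_conj_mul_ne_zero a z))]
  refine (sq_le_sq₀ (norm_nonneg _) (norm_nonneg _)).mp ?_
  have ha := a.normSq_lt_one
  have hz := z.normSq_lt_one
  rw [Complex.sq_norm, Complex.sq_norm]
  simp only [Complex.normSq_apply, Complex.sub_re, Complex.sub_im, Complex.mul_re,
    Complex.mul_im, Complex.conj_re, Complex.conj_im, Complex.one_re, Complex.one_im] at *
  nlinarith [mul_nonneg (sub_nonneg.mpr ha.le) (sub_nonneg.mpr hz.le)]

/-- The Blaschke factor as an element of `H^∞`. -/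
def blaschke (a : 𝔻) : HInf :=
  ⟨BoundedContinuousFunction.ofNormedAddCommGroup (blaschkeFun a)
    (by
      unfold blaschkeFun
      exact Continuous.div (by fun_prop) (by fun_prop) (one_sub_conj_mul_ne_zero a)) 1
    (norm_blaschkeFun_le a), by
    have h : DifferentiableOn ℂ (fun z : ℂ => (z - a) / (1 - conj (a : ℂ) * z))
        (Metric.ball 0 1) := by
      refine DifferentiableOn.div (by fun_prop) (by fun_prop) fun z hz => ?_
      have hz' : ‖z‖ < 1 := by simpa using hz
      exact one_sub_conj_mul_ne_zero a (Complex.UnitDisc.mk z hz')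
    refine h.congr fun z hz => ?_
    have hz' : ‖z‖ < 1 := by simpa using hz
    simp [ext, hz', blaschkeFun]⟩

/-- The finite Blaschke product `b_{λ_1} ⋯ b_{λ_N}`; the roots may be repeated. -/
def blaschkeProd {N : ℕ} (lam : Fin N → 𝔻) : HInf := ∏ j, blaschke (lam j)

/-- `η = sup_{j,k} |b_{λ_j}(λ_k)|^{1/2} / (1 - max(|λ_j|,|λ_k|)^2)^{1/2}`. -/
def eta {N : ℕ} (lam : Fin N → 𝔻) : ℝ :=
  ⨆ p : Fin N × Fin N, Real.sqrt ‖blaschkeFun (lam p.1) (lam p.2)‖ /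
    Real.sqrt (1 - max ‖(lam p.1 : ℂ)‖ ‖(lam p.2 : ℂ)‖ ^ 2)

/-! ### Contractions and the functional calculus -/

section Operators

set_option linter.unusedSectionVars false

variable {H : Type*} [NormedAddCommGroup H] [InnerProductSpace ℂ H] [CompleteSpace H]

/-- A completely non-unitary contraction: a contraction such that the zero space is the only
closed subspace which reduces it to a unitary operator. -/
def IsCNUContraction (T : H →L[ℂ] H) : Prop :=
  ‖T‖ ≤ 1 ∧ ∀ M : Submodule ℂ H, IsClosed (M : Set H) →
    (∀ x ∈ Mᗮ, T x ∈ Mᗮ) → M.map T.toLinearMap = M → (∀ x ∈ M, ‖T x‖ = ‖x‖) → M = ⊥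

/-- `u(rT) = ∑ r^n a_n T^n`, where `∑ a_n z^n` is the Taylor series of `u`. For a contraction `T`
and `0 ≤ r < 1` the series converges absolutely. -/
def dilate (T : H →L[ℂ] H) (u : HInf) (r : ℝ) : H →L[ℂ] H :=
  ∑' n : ℕ, ((r : ℂ) ^ n * u.coeff n) • T ^ n

/-- `A = u(T)` in the Sz.-Nagy--Foias functional calculus: `u(T)` is the strong limit of
`u(rT)` as `r` increases to `1`. (It exists for all `u` when `T` is a completely non-unitary
contraction.) -/
def HasCalculus (T : H →L[ℂ] H) (u : HInf) (A : H →L[ℂ] H) : Prop :=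
  ∀ x : H, Filter.Tendsto (fun r : ℝ => dilate T u r x) (𝓝[<] 1) (𝓝 (A x))

/-- Class `C_0`: completely non-unitary contractions annihilated by some nonzero `u ∈ H^∞`. -/
def IsClassC0 (T : H →L[ℂ] H) : Prop :=
  IsCNUContraction T ∧ ∃ u : HInf, u ≠ 0 ∧ HasCalculus T u 0

/-- The inner function `θ` is a minimal function of `T`: `{u ∈ H^∞ : u(T) = 0} = θ H^∞`. -/
def IsMinimalFunction (T : H →L[ℂ] H) (θ : HInf) : Prop :=
  IsInner θ ∧ ∀ u : HInf, HasCalculus T u 0 ↔ θ ∣ u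

/-- Multiplicity-free operators: those having a cyclic vector. -/
def IsMultiplicityFree (T : H →L[ℂ] H) : Prop :=
  ∃ x : H, (Submodule.span ℂ (Set.range fun n : ℕ => (T ^ n) x)).topologicalClosure = ⊤

lemma eventually_radius : ∀ᶠ r : ℝ in 𝓝[<] 1, 0 ≤ r ∧ r < 1 := by
  have h : Set.Ioo (0 : ℝ) 1 ∈ 𝓝[<] (1 : ℝ) := Ioo_mem_nhdsLT one_pos
  filter_upwards [h] with r hr using ⟨hr.1.le, hr.2⟩

lemma norm_pow_le_one' {T : H →L[ℂ] H} (hT : ‖T‖ ≤ 1) (n : ℕ) : ‖T ^ n‖ ≤ 1 := by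
  rcases n with _ | n
  · rw [pow_zero]
    exact ContinuousLinearMap.norm_id_le
  · exact (norm_pow_le' T n.succ_pos).trans (pow_le_one₀ (norm_nonneg _) hT)

lemma summable_norm_dilate {T : H →L[ℂ] H} (hT : ‖T‖ ≤ 1) (u : HInf) {r : ℝ} (h0 : 0 ≤ r)
    (h1 : r < 1) : Summable fun n : ℕ => ‖((r : ℂ) ^ n * u.coeff n) • T ^ n‖ := by
  refine (u.summable_norm_coeff h0 h1).of_nonneg_of_le (fun _ => norm_nonneg _) fun n => ?_
  rw [norm_smul]
  exact mul_le_of_le_one_right (norm_nonneg _) (norm_pow_le_one' hT n)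

lemma dilate_add {T : H →L[ℂ] H} (hT : ‖T‖ ≤ 1) (u v : HInf) {r : ℝ} (h0 : 0 ≤ r) (h1 : r < 1) :
    dilate T (u + v) r = dilate T u r + dilate T v r := by
  unfold dilate
  rw [← (summable_norm_dilate hT u h0 h1).of_norm.tsum_add
    (summable_norm_dilate hT v h0 h1).of_norm]
  refine tsum_congr fun n => ?_
  rw [HInf.coeff_add, mul_add, add_smul]

lemma dilate_mul {T : H →L[ℂ] H} (hT : ‖T‖ ≤ 1) (u v : HInf) {r : ℝ} (h0 : 0 ≤ r) (h1 : r < 1) :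
    dilate T (u * v) r = dilate T u r * dilate T v r := by
  unfold dilate
  rw [tsum_mul_tsum_eq_tsum_sum_range_of_summable_norm (summable_norm_dilate hT u h0 h1)
    (summable_norm_dilate hT v h0 h1)]
  refine tsum_congr fun n => ?_
  rw [HInf.coeff_mul, Finset.mul_sum, Finset.sum_smul]
  refine Finset.sum_congr rfl fun k hk => ?_
  have hk' : k + (n - k) = n := Nat.add_sub_cancel' (Nat.lt_succ_iff.mp (Finset.mem_range.mp hk))
  rw [smul_mul_smul_comm, ← pow_add, hk']
  congr 1
  nth_rewrite 1 [← hk']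
  rw [pow_add]
  ring

lemma dilate_algebraMap (T : H →L[ℂ] H) (c : ℂ) (r : ℝ) :
    dilate T (algebraMap ℂ HInf c) r = algebraMap ℂ (H →L[ℂ] H) c := by
  unfold dilate
  rw [tsum_eq_single 0]
  · rw [HInf.coeff_algebraMap, Algebra.algebraMap_eq_smul_one]
    simp
  · intro n hn
    rw [HInf.coeff_algebraMap, if_neg hn, mul_zero, zero_smul]

lemma HasCalculus.add {T : H →L[ℂ] H} (hT : ‖T‖ ≤ 1) {u v : HInf} {A B : H →L[ℂ] H}
    (hA : HasCalculus T u A) (hB : HasCalculus T v B) : HasCalculus T (u + v) (A + B) := by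
  intro x
  refine ((hA x).add (hB x)).congr' ?_
  filter_upwards [eventually_radius] with r hr
  rw [dilate_add hT u v hr.1 hr.2]
  rfl

lemma HasCalculus.mul {T : H →L[ℂ] H} (hT : ‖T‖ ≤ 1) {u v : HInf} {A B : H →L[ℂ] H}
    (hA : HasCalculus T u A) (hB : HasCalculus T v B) : HasCalculus T (u * v) (A * B) := by
  intro x
  refine Filter.tendsto_of_seq_tendsto fun s hs => ?_
  obtain ⟨C, hC⟩ : ∃ C, ∀ n, ‖dilate T u (s n)‖ ≤ C := by
    refine banach_steinhaus fun y => ?_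
    obtain ⟨C, hC⟩ := ((hA y).comp hs).norm.bddAbove_range
    exact ⟨C, fun n => hC ⟨n, rfl⟩⟩
  have h1 : Filter.Tendsto (fun n => dilate T u (s n) (B x)) Filter.atTop (𝓝 (A (B x))) :=
    (hA (B x)).comp hs
  have h2 : Filter.Tendsto (fun n => dilate T u (s n) (dilate T v (s n) x - B x))
      Filter.atTop (𝓝 0) := by
    have h3 : Filter.Tendsto (fun n => C * ‖dilate T v (s n) x - B x‖) Filter.atTop (𝓝 0) := by
      have h4 := (((hB x).comp hs).sub_const (B x)).norm.const_mul C
      simpa using h4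
    exact squeeze_zero_norm (fun n => (dilate T u (s n)).le_of_opNorm_le (hC n) _) h3
  have h5 := h1.add h2
  rw [add_zero] at h5
  refine h5.congr' ?_
  filter_upwards [hs.eventually eventually_radius] with n hn
  rw [Function.comp_apply, dilate_mul hT u v hn.1 hn.2, ← map_add, add_sub_cancel]
  rfl

/-- The operator algebra `H^∞(T) = {u(T) : u ∈ H^∞}` of a contraction `T`, with the operator
norm. -/
def HInfAlg (T : H →L[ℂ] H) (hT : ‖T‖ ≤ 1) : Subalgebra ℂ (H →L[ℂ] H) where
  carrier := {A | ∃ u : HInf, HasCalculus T u A}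
  mul_mem' := by
    rintro A B ⟨u, hu⟩ ⟨v, hv⟩
    exact ⟨u * v, hu.mul hT hv⟩
  add_mem' := by
    rintro A B ⟨u, hu⟩ ⟨v, hv⟩
    exact ⟨u + v, hu.add hT hv⟩
  algebraMap_mem' c := ⟨algebraMap ℂ HInf c, fun x => by
    simp only [dilate_algebraMap]
    exact tendsto_const_nhds⟩

end Operators

/-! ### The Hardy space and Jordan blocks -/

/-- The Hardy space `H^2`, each function being given by its square summable sequence of Taylor
coefficients. -/
abbrev H2 : Type := lp (fun _ : ℕ => ℂ) 2

/-- The holomorphic function `f(z) = ∑ a_n z^n` on the disc defined by `f ∈ H^2`. -/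
def H2.eval (f : H2) (z : 𝔻) : ℂ := ∑' n : ℕ, f n * (z : ℂ) ^ n

lemma H2.summable (f : H2) (z : 𝔻) : Summable fun n : ℕ => f n * (z : ℂ) ^ n := by
  refine Summable.of_norm_bounded
    ((summable_geometric_of_lt_one (norm_nonneg _) z.norm_lt_one).mul_left ‖f‖) fun n => ?_
  rw [norm_mul, norm_pow]
  gcongr
  exact lp.norm_apply_le_norm two_ne_zero f n

lemma H2.eval_add (f g : H2) (z : 𝔻) : (f + g).eval z = f.eval z + g.eval z := by
  unfold H2.eval
  rw [← (f.summable z).tsum_add (g.summable z)]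
  refine tsum_congr fun n => ?_
  rw [lp.coeFn_add, Pi.add_apply, add_mul]

lemma H2.eval_smul (c : ℂ) (f : H2) (z : 𝔻) : (c • f).eval z = c * f.eval z := by
  unfold H2.eval
  rw [← tsum_mul_left]
  refine tsum_congr fun n => ?_
  rw [lp.coeFn_smul, Pi.smul_apply, smul_eq_mul, mul_assoc]

/-- The sequence `(0, a_0, a_1, …)`. -/
def shiftSeq (f : ℕ → ℂ) : ℕ → ℂ
  | 0 => 0
  | n + 1 => f n

lemma shiftSeq_memℓp (f : H2) : Memℓp (shiftSeq f) 2 := by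
  have h := (memℓp_gen_iff (p := 2) (by norm_num)).mp (lp.memℓp f)
  refine (memℓp_gen_iff (p := 2) (by norm_num)).mpr ?_
  exact (summable_nat_add_iff (f := fun n => ‖shiftSeq f n‖ ^ (2 : ENNReal).toReal) 1).mp h

/-- The shift `S` on `H^2`: `(S f)(z) = z f(z)`. -/
def shift : H2 →ₗᵢ[ℂ] H2 where
  toFun f := ⟨shiftSeq f, shiftSeq_memℓp f⟩
  map_add' f g := by
    ext n
    rcases n with _ | n
    · exact (add_zero (0 : ℂ)).symm
    · rfl
  map_smul' c f := by
    ext n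
    rcases n with _ | n <;> simp [shiftSeq]
  norm_map' f := by
    have h2 : 0 < (2 : ENNReal).toReal := by norm_num
    rw [lp.norm_eq_tsum_rpow h2, lp.norm_eq_tsum_rpow h2]
    congr 1
    have h := (memℓp_gen_iff h2).mp (shiftSeq_memℓp f)
    have h' := h.tsum_eq_zero_add
    simpa [shiftSeq] using h'

lemma shift_eval (f : H2) (z : 𝔻) : (shift f).eval z = (z : ℂ) * f.eval z := by
  have h := ((shift f).summable z).tsum_eq_zero_add
  have h0 : (shift f : H2) 0 = 0 := rfl
  have h1 : ∀ n, (shift f : H2) (n + 1) = f n := fun _ => rfl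
  unfold H2.eval
  rw [h, h0, zero_mul, zero_add, ← tsum_mul_left]
  refine tsum_congr fun n => ?_
  rw [h1]
  ring

/-- The subspace `θ H^2` of `H^2`. -/
def mulRange (θ : HInf) : Submodule ℂ H2 where
  carrier := {f | ∃ g : H2, ∀ z : 𝔻, f.eval z = θ.eval z * g.eval z}
  zero_mem' := ⟨0, fun z => by simp [H2.eval]⟩
  add_mem' := by
    rintro f₁ f₂ ⟨g₁, h₁⟩ ⟨g₂, h₂⟩
    exact ⟨g₁ + g₂, fun z => by rw [H2.eval_add, H2.eval_add, h₁, h₂, mul_add]⟩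
  smul_mem' := by
    rintro c f ⟨g, h⟩
    exact ⟨c • g, fun z => by rw [H2.eval_smul, H2.eval_smul, h]; ring⟩

lemma shift_mem_mulRange (θ : HInf) {f : H2} (hf : f ∈ mulRange θ) : shift f ∈ mulRange θ := by
  obtain ⟨g, hg⟩ := hf
  exact ⟨shift g, fun z => by rw [shift_eval, shift_eval, hg]; ring⟩

/-- The model space `H(θ) = H^2 ⊖ θ H^2`. -/
abbrev ModelSpace (θ : HInf) : Type := ↥((mulRange θ)ᗮ)

/-- The adjoint `S^*` of the shift. -/
def backShift : H2 →L[ℂ] H2 := ContinuousLinearMap.adjoint shift.toContinuousLinearMap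

lemma backShift_mem (θ : HInf) {f : H2} (hf : f ∈ (mulRange θ)ᗮ) :
    backShift f ∈ (mulRange θ)ᗮ := by
  rw [Submodule.mem_orthogonal] at hf ⊢
  intro g hg
  rw [backShift, ContinuousLinearMap.adjoint_inner_right]
  exact hf _ (shift_mem_mulRange θ hg)

/-- The restriction of `S^*` to `H(θ)`. -/
def backShiftRestrict (θ : HInf) : ModelSpace θ →L[ℂ] ModelSpace θ :=
  (backShift.comp (mulRange θ)ᗮ.subtypeL).codRestrict (mulRange θ)ᗮ
    fun f => backShift_mem θ f.2

/-- The Jordan block `S(θ)` on `H(θ)`, defined by `S(θ)^* = S^* | H(θ)`. -/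
def jordanBlock (θ : HInf) : ModelSpace θ →L[ℂ] ModelSpace θ :=
  ContinuousLinearMap.adjoint (backShiftRestrict θ)

lemma norm_jordanBlock_le (θ : HInf) : ‖jordanBlock θ‖ ≤ 1 := by
  rw [jordanBlock, LinearIsometryEquiv.norm_map]
  refine ContinuousLinearMap.opNorm_le_bound _ zero_le_one fun f => ?_
  have h1 : ‖backShift‖ ≤ 1 := by
    rw [backShift, LinearIsometryEquiv.norm_map]
    exact shift.norm_toContinuousLinearMap_le
  exact backShift.le_of_opNorm_le h1 _

end

end CZero

/-!
The hypothesis `0 < β` says that `5 √2 η < 1 / ‖Ψ‖`, and this forces the points `λ_j` to be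
pseudo-hyperbolically close: `|b_{λ_j}(λ_k)| ≤ η ^ 2 ≤ 1 / (50 ‖Ψ‖ ^ 2)`. After a Möbius
transformation, `T` is thus close to being nilpotent, and a similarity can be written down.

Put `M = ‖Ψ‖`, `B_j = b_{λ_j}(T)`, and fix one index `i`. On the model space the product of the
factors other than `b_{λ_i}` has norm one, because it acts isometrically on the Szegő kernel at
`λ_i` (`one_le_norm_mobProd_jordanBlock`). Hence `‖∏_{j ≠ i} B_j‖ ≥ 1 / M`, and some `x` in the unit ball
satisfies `‖∏_{j ≠ i} B_j x‖ ≥ 1 / (2 M)`. Since `B_k` differs from a unimodular multiple of `B_i`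
by at most `2 |b_{λ_i}(λ_k)|` (`exists_norm_mob_sub_smul_mob_le`), the same `x` satisfies
`‖∏_{j ≠ k} B_j x‖ ≥ 1 / (4 M)` for all `k` (`exists_vector`).

Consider the vectors `v_n = ∏_{j < n} B_j x` for `n < N`. They lie in the unit ball. Applying
`∏_{j > k} B_j` to a combination `∑ a_n v_n` kills the terms with `n > k` and turns `v_k` into
`∏_{j ≠ k} B_j x`; this bounds the coefficients one after the other, and
`∑ |a_n| ≤ (1 + 4 M) ^ N ‖∑ a_n v_n‖` (`sum_norm_le_norm_sum_newtonVec`). A cyclic operator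
annihilated by a polynomial of degree `N` lives on a space of dimension at most `N`, so the `v_n` form a basis.
The same holds for `S(θ)`. As `T` acts on the `v_n` by a rule which only involves the `λ_j`
(`apply_newtonVec`), the operator matching the two bases is the required similarity, and it and its
inverse are bounded by `(1 + 4 M) ^ N` (`exists_similarity`).
-/

namespace CZero

noncomputable section

/-! ### Möbius transforms of a contraction -/

section Mobius

variable {H : Type*} [NormedAddCommGroup H] [InnerProductSpace ℂ H]

/-- The denominator `1 - conj a T` of the Möbius transform `b_a(T)`. -/
def mobDen (a : 𝔻) (T : H →L[ℂ] H) : H →L[ℂ] H := 1 - conj (a : ℂ) • T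

/-- The operator `b_a(T) = (1 - conj a T)⁻¹ (T - a)`. `Ring.inverse` is a true inverse here as soon
as `‖T‖ ≤ 1`. -/
def mob (a : 𝔻) (T : H →L[ℂ] H) : H →L[ℂ] H :=
  Ring.inverse (mobDen a T) * (T - (a : ℂ) • 1)

lemma norm_sub_smul_sq_add (a : ℂ) (x y : H) :
    ‖y - a • x‖ ^ 2 + (1 - ‖a‖ ^ 2) * (‖x‖ ^ 2 - ‖y‖ ^ 2) = ‖x - conj a • y‖ ^ 2 := by
  have h : RCLike.re (inner ℂ y (a • x)) = RCLike.re (inner ℂ x (conj a • y)) := by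
    rw [inner_smul_right, inner_smul_right, ← inner_conj_symm y x]
    simp [-inner_conj_symm]
  rw [@norm_sub_sq ℂ, @norm_sub_sq ℂ, h, norm_smul, norm_smul, Complex.norm_conj]
  ring

lemma commute_mobDen {X T : H →L[ℂ] H} (h : Commute X T) (a : 𝔻) : Commute X (mobDen a T) :=
  (Commute.one_right X).sub_right (h.smul_right _)

variable [CompleteSpace H]

lemma isUnit_mobDen (a : 𝔻) {T : H →L[ℂ] H} (hT : ‖T‖ ≤ 1) : IsUnit (mobDen a T) := by
  refine isUnit_one_sub_of_norm_lt_one ?_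
  rw [norm_smul, Complex.norm_conj]
  exact (mul_le_of_le_one_right (norm_nonneg _) hT).trans_lt a.norm_lt_one

lemma mobDen_mul_mob (a : 𝔻) {T : H →L[ℂ] H} (hT : ‖T‖ ≤ 1) :
    mobDen a T * mob a T = T - (a : ℂ) • 1 := by
  rw [mob, ← mul_assoc, Ring.mul_inverse_cancel _ (isUnit_mobDen a hT), one_mul]

lemma commute_mob {X T : H →L[ℂ] H} (hT : ‖T‖ ≤ 1) (h : Commute X T) (a : 𝔻) :
    Commute X (mob a T) := by
  obtain ⟨u, hu⟩ := isUnit_mobDen a hT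
  have h1 : Commute X (u : H →L[ℂ] H) := hu ▸ commute_mobDen h a
  rw [mob, ← hu, Ring.inverse_unit]
  exact h1.units_inv_right.mul_right (h.sub_right ((Commute.one_right X).smul_right _))

lemma mob_mul_mobDen (a : 𝔻) {T : H →L[ℂ] H} (hT : ‖T‖ ≤ 1) :
    mob a T * mobDen a T = T - (a : ℂ) • 1 := by
  rw [← mobDen_mul_mob a hT]
  exact ((commute_mob hT (commute_mobDen (Commute.refl T) a).symm a).eq).symm

lemma norm_mob_apply_sq (a : 𝔻) {T : H →L[ℂ] H} (hT : ‖T‖ ≤ 1) (y : H) :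
    ‖mob a T (mobDen a T y)‖ ^ 2 + (1 - ‖(a : ℂ)‖ ^ 2) * (‖y‖ ^ 2 - ‖T y‖ ^ 2) =
      ‖mobDen a T y‖ ^ 2 := by
  rw [← mul_apply_eq_comp, mob_mul_mobDen a hT]
  exact norm_sub_smul_sq_add (a : ℂ) y (T y)

lemma exists_mobDen_apply_eq (a : 𝔻) {T : H →L[ℂ] H} (hT : ‖T‖ ≤ 1) (z : H) :
    ∃ y, mobDen a T y = z :=
  ⟨Ring.inverse (mobDen a T) z, by
    rw [← mul_apply_eq_comp, Ring.mul_inverse_cancel _ (isUnit_mobDen a hT),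
      one_apply_eq_self]⟩

/-- The case of von Neumann's inequality that is needed: `b_a(T)` is a contraction. -/
lemma norm_mob_le (a : 𝔻) {T : H →L[ℂ] H} (hT : ‖T‖ ≤ 1) : ‖mob a T‖ ≤ 1 := by
  refine ContinuousLinearMap.opNorm_le_bound _ zero_le_one fun z => ?_
  obtain ⟨y, rfl⟩ := exists_mobDen_apply_eq a hT z
  rw [one_mul]
  refine (sq_le_sq₀ (norm_nonneg _) (norm_nonneg _)).mp ?_
  have h1 : ‖T y‖ ≤ ‖y‖ := by simpa using T.le_of_opNorm_le hT y
  have h2 : 0 ≤ 1 - ‖(a : ℂ)‖ ^ 2 := by nlinarith [a.norm_lt_one, norm_nonneg (a : ℂ)]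
  have h3 : 0 ≤ ‖y‖ ^ 2 - ‖T y‖ ^ 2 := by nlinarith [norm_nonneg (T y)]
  linarith [norm_mob_apply_sq a hT y, mul_nonneg h2 h3]

lemma norm_mob_apply_of_isometry (a : 𝔻) {T : H →L[ℂ] H} (hT : ‖T‖ ≤ 1)
    (h : ∀ y, ‖T y‖ = ‖y‖) (z : H) : ‖mob a T z‖ = ‖z‖ := by
  obtain ⟨y, rfl⟩ := exists_mobDen_apply_eq a hT z
  refine (sq_eq_sq₀ (norm_nonneg _) (norm_nonneg _)).mp ?_
  have := norm_mob_apply_sq a hT y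
  rwa [h, sub_self, mul_zero, add_zero] at this

/-- With `ν = b_a(b)` one has `b_b = ω b_ν ∘ b_a` for some `|ω| = 1`. The bound then comes from
`b_ν(w) - w = conj ν w b_ν(w) - ν`. -/
lemma exists_norm_mob_sub_smul_mob_le (a b : 𝔻) {T : H →L[ℂ] H} (hT : ‖T‖ ≤ 1) :
    ∃ ω : ℂ, ‖ω‖ = 1 ∧ ‖mob b T - ω • mob a T‖ ≤ 2 * ‖blaschkeFun a b‖ := by
  set ν := blaschkeFun a b with hν
  have hd : (1 : ℂ) - conj (a : ℂ) * b ≠ 0 := one_sub_conj_mul_ne_zero a b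
  have hd' : (1 : ℂ) - a * conj (b : ℂ) ≠ 0 := by
    have := (map_ne_zero (starRingEnd ℂ)).mpr hd
    simpa using this
  set ω : ℂ := (1 - conj (a : ℂ) * b) / (1 - a * conj (b : ℂ)) with hω
  have hων : ‖ω‖ = 1 := by
    have h : (1 : ℂ) - a * conj (b : ℂ) = conj (1 - conj (a : ℂ) * b) := by simp
    rw [hω, h, norm_div, Complex.norm_conj, div_self (norm_ne_zero_iff.mpr hd)]
  have hν' : conj ν = (conj (b : ℂ) - conj (a : ℂ)) / (1 - a * conj (b : ℂ)) := by
    rw [hν, blaschkeFun]; simp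
  have key : mob b T - ω • mob a T = conj ν • (mob b T * mob a T) - (ω * ν) • 1 := by
    -- Both sides agree after multiplication by the two invertible denominators.
    refine (isUnit_mobDen b hT).mul_left_cancel ((isUnit_mobDen a hT).mul_right_cancel ?_)
    have e1 : mobDen b T * mob b T * mobDen a T = (T - (b : ℂ) • 1) * mobDen a T := by
      rw [mobDen_mul_mob b hT]
    have e2 : mobDen b T * mob a T * mobDen a T = mobDen b T * (T - (a : ℂ) • 1) := by
      rw [mul_assoc, mob_mul_mobDen a hT]
    have e3 : mobDen b T * (mob b T * mob a T) * mobDen a T =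
        (T - (b : ℂ) • 1) * (T - (a : ℂ) • 1) := by
      rw [← mul_assoc, mobDen_mul_mob b hT, mul_assoc, mob_mul_mobDen a hT]
    have e4 : ω * ν = ((b : ℂ) - a) / (1 - a * conj (b : ℂ)) := by
      rw [hω, hν, blaschkeFun]
      field_simp
    simp only [mul_sub, sub_mul, mul_smul_comm, smul_mul_assoc, mul_one]
    rw [e1, e2, e3, e4, hν', hω]
    simp only [mobDen, mul_sub, sub_mul, mul_smul_comm, smul_mul_assoc, mul_one, one_mul]
    match_scalars <;> field_simp <;> ring
  refine ⟨ω, hων, ?_⟩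
  rw [key]
  refine (norm_sub_le _ _).trans ?_
  rw [norm_smul, norm_smul, norm_mul ω, Complex.norm_conj, hων, one_mul]
  have h1 : ‖mob b T * mob a T‖ ≤ 1 :=
    (norm_mul_le _ _).trans (mul_le_one₀ (norm_mob_le b hT) (norm_nonneg _) (norm_mob_le a hT))
  have h2 : ‖(1 : H →L[ℂ] H)‖ ≤ 1 := ContinuousLinearMap.norm_id_le
  nlinarith [norm_nonneg ν]

end Mobius

/-! ### The functional calculus on finite Blaschke products -/

section Calculus

variable {H : Type*} [NormedAddCommGroup H] [InnerProductSpace ℂ H]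

lemma coeff_blaschke_zero (n : ℕ) : (blaschke 0).coeff n = if n = 1 then 1 else 0 := by
  have h : ext (blaschke 0).eval =ᶠ[𝓝 0] fun z => z := by
    filter_upwards [Metric.isOpen_ball.mem_nhds (Metric.mem_ball_self (x := (0 : ℂ)) one_pos)]
      with z hz
    have hz' : ‖z‖ < 1 := by simpa using hz
    simp [ext, hz', HInf.eval, blaschke, blaschkeFun]
  rw [HInf.coeff, h.iteratedDeriv_eq n, iteratedDeriv_fun_id]
  rcases n with _ | _ | n <;> simp

lemma dilate_blaschke_zero (T : H →L[ℂ] H) (r : ℝ) : dilate T (blaschke 0) r = (r : ℂ) • T := by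
  unfold dilate
  rw [tsum_eq_single 1]
  · simp [coeff_blaschke_zero]
  · intro n hn
    simp [coeff_blaschke_zero, hn]

/-- `b_a = (z - a) + conj a z b_a`, where `z = b_0`. -/
lemma blaschke_add_algebraMap (a : 𝔻) :
    blaschke a + algebraMap ℂ HInf a =
      blaschke 0 + algebraMap ℂ HInf (conj (a : ℂ)) * (blaschke 0 * blaschke a) := by
  refine Subtype.ext (DFunLike.ext _ _ fun z => ?_)
  have h := one_sub_conj_mul_ne_zero a z
  have e : ∀ b : 𝔻, (blaschke b : 𝔻 →ᵇ ℂ) z = blaschkeFun b z := fun _ => rfl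
  have e' : ∀ c : ℂ, algebraMap ℂ (𝔻 →ᵇ ℂ) c z = c := fun _ => rfl
  push_cast
  simp only [BoundedContinuousFunction.coe_add, BoundedContinuousFunction.coe_mul, Pi.add_apply,
    Pi.mul_apply, e, e', blaschkeFun, Complex.UnitDisc.coe_zero, map_zero, zero_mul,
    sub_zero, div_one]
  linear_combination div_mul_cancel₀ ((z : ℂ) - a) h

lemma dilate_blaschke [CompleteSpace H] (a : 𝔻) {T : H →L[ℂ] H} (hT : ‖T‖ ≤ 1) {r : ℝ}
    (h0 : 0 ≤ r) (h1 : r < 1) : dilate T (blaschke a) r = mob a ((r : ℂ) • T) := by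
  have hrT : ‖(r : ℂ) • T‖ ≤ 1 := by
    rw [norm_smul, Complex.norm_real, Real.norm_of_nonneg h0]
    exact mul_le_one₀ h1.le (norm_nonneg _) hT
  have h := congrArg (fun u => dilate T u r) (blaschke_add_algebraMap a)
  simp only [dilate_add hT _ _ h0 h1, dilate_mul hT _ _ h0 h1, dilate_algebraMap,
    dilate_blaschke_zero] at h
  simp only [Algebra.algebraMap_eq_smul_one, smul_one_mul] at h
  refine (isUnit_mobDen a hrT).mul_left_cancel ?_
  rw [mobDen_mul_mob a hrT, mobDen, sub_mul, one_mul, smul_mul_assoc, sub_eq_sub_iff_add_eq_add]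
  exact h

lemma hasCalculus_blaschke [CompleteSpace H] (a : 𝔻) {T : H →L[ℂ] H} (hT : ‖T‖ ≤ 1) :
    HasCalculus T (blaschke a) (mob a T) := by
  have h1 : Filter.Tendsto (fun r : ℝ => (r : ℂ) • T) (𝓝[<] 1) (𝓝 T) := by
    have h : Continuous fun r : ℝ => (r : ℂ) • T := by fun_prop
    simpa using (h.tendsto 1).mono_left nhdsWithin_le_nhds
  obtain ⟨v, hv⟩ := isUnit_mobDen a hT
  have h2 : Filter.Tendsto (fun r : ℝ => Ring.inverse (mobDen a ((r : ℂ) • T))) (𝓝[<] 1)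
      (𝓝 (Ring.inverse (mobDen a T))) := by
    have h : ContinuousAt Ring.inverse (mobDen a T) := hv ▸ NormedRing.inverse_continuousAt v
    exact h.tendsto.comp ((h1.const_smul _).const_sub 1)
  have h3 : Filter.Tendsto (fun r : ℝ => mob a ((r : ℂ) • T)) (𝓝[<] 1) (𝓝 (mob a T)) :=
    h2.mul (h1.sub_const _)
  intro x
  refine (((ContinuousLinearMap.apply ℂ H x).continuous.tendsto _).comp h3).congr' ?_
  filter_upwards [eventually_radius] with r hr
  rw [dilate_blaschke a hT hr.1 hr.2]
  rfl

lemma HasCalculus.unique {T : H →L[ℂ] H} {u : HInf} {A B : H →L[ℂ] H}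
    (hA : HasCalculus T u A) (hB : HasCalculus T u B) : A = B :=
  ContinuousLinearMap.ext fun x => tendsto_nhds_unique (hA x) (hB x)

lemma hasCalculus_algebraMap [CompleteSpace H] (T : H →L[ℂ] H) (c : ℂ) :
    HasCalculus T (algebraMap ℂ HInf c) (algebraMap ℂ (H →L[ℂ] H) c) := fun x =>
  tendsto_const_nhds.congr fun r => by rw [dilate_algebraMap]

variable [CompleteSpace H] {ι : Type*}

/-- The operator `∏_{j ∈ s} b_{λ_j}(T)`; the factors commute. -/
def mobProd {T : H →L[ℂ] H} (hT : ‖T‖ ≤ 1) (lam : ι → 𝔻) (s : Finset ι) : H →L[ℂ] H :=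
  s.noncommProd (fun j => mob (lam j) T) fun _ _ _ _ _ =>
    commute_mob hT (commute_mob hT (Commute.refl T) _).symm _

variable {T : H →L[ℂ] H} (hT : ‖T‖ ≤ 1) (lam : ι → 𝔻)

@[simp] lemma mobProd_empty : mobProd hT lam ∅ = 1 := rfl

lemma commute_mobProd {X : H →L[ℂ] H} (h : Commute X T) (s : Finset ι) :
    Commute X (mobProd hT lam s) :=
  Finset.noncommProd_commute _ _ _ _ fun j _ => commute_mob hT h (lam j)

variable [DecidableEq ι]

lemma mobProd_insert {s : Finset ι} {j : ι} (hj : j ∉ s) :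
    mobProd hT lam (insert j s) = mob (lam j) T * mobProd hT lam s :=
  Finset.noncommProd_insert_of_notMem _ _ _ _ hj

lemma mobProd_union {s t : Finset ι} (h : Disjoint s t) :
    mobProd hT lam (s ∪ t) = mobProd hT lam s * mobProd hT lam t :=
  Finset.noncommProd_union_of_disjoint h _ _

lemma norm_mobProd_le (s : Finset ι) : ‖mobProd hT lam s‖ ≤ 1 := by
  induction s using Finset.induction_on with
  | empty => exact ContinuousLinearMap.norm_id_le
  | insert j s hj ih =>
    rw [mobProd_insert hT lam hj]
    exact (norm_mul_le _ _).trans (mul_le_one₀ (norm_mob_le _ hT) (norm_nonneg _) ih)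

lemma norm_mobProd_apply_of_isometry (h : ∀ y, ‖T y‖ = ‖y‖) (s : Finset ι) (z : H) :
    ‖mobProd hT lam s z‖ = ‖z‖ := by
  induction s using Finset.induction_on with
  | empty => rfl
  | insert j s hj ih =>
    rw [mobProd_insert hT lam hj, mul_apply_eq_comp, norm_mob_apply_of_isometry _ hT h, ih]

lemma hasCalculus_mobProd (s : Finset ι) :
    HasCalculus T (∏ j ∈ s, blaschke (lam j)) (mobProd hT lam s) := by
  induction s using Finset.induction_on with
  | empty =>
    have h := hasCalculus_algebraMap T 1
    rwa [map_one, map_one] at h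
  | insert j s hj ih =>
    rw [mobProd_insert hT lam hj, Finset.prod_insert hj]
    exact (hasCalculus_blaschke _ hT).mul hT ih

lemma exists_aeval_eq_mobProd_mul (s : Finset ι) :
    ∃ D, Polynomial.aeval T (∏ j ∈ s, (Polynomial.X - Polynomial.C (lam j : ℂ))) =
      mobProd hT lam s * D := by
  induction s using Finset.induction_on with
  | empty => exact ⟨1, by simp⟩
  | insert j s hj ih =>
    obtain ⟨D, hD⟩ := ih
    refine ⟨mobDen (lam j) T * D, ?_⟩
    have hc : Commute (mobDen (lam j) T) (mobProd hT lam s) :=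
      commute_mobProd hT lam (commute_mobDen (Commute.refl T) _).symm s
    rw [Finset.prod_insert hj, map_mul, hD, mobProd_insert hT lam hj, map_sub, Polynomial.aeval_X,
      Polynomial.aeval_C, Algebra.algebraMap_eq_smul_one, ← mob_mul_mobDen _ hT, mul_assoc,
      mul_assoc, ← mul_assoc (mobDen (lam j) T), hc.eq, mul_assoc]

variable [Fintype ι]

lemma mobProd_mul_mobProd_eq_zero (h0 : mobProd hT lam Finset.univ = 0) {s t : Finset ι}
    (h : s ∪ t = Finset.univ) : mobProd hT lam s * mobProd hT lam t = 0 := by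
  have h1 : s ∪ (t \ s) = Finset.univ := by rw [Finset.union_sdiff_self_eq_union, h]
  have h2 : t \ (t \ s) ∪ (t \ s) = t := Finset.sdiff_union_of_subset Finset.sdiff_subset
  have h3 : mobProd hT lam t = mobProd hT lam (t \ s) * mobProd hT lam (t \ (t \ s)) := by
    rw [← mobProd_union hT lam Finset.disjoint_sdiff, Finset.union_comm, h2]
  rw [h3, ← mul_assoc, ← mobProd_union hT lam Finset.disjoint_sdiff, h1, h0, zero_mul]

/-- If the points `λ_j` are pseudo-hyperbolically close to `λ_i`, then removing any one factor
from `∏ b_{λ_j}(T)` gives almost the same operator up to a unimodular constant. -/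
lemma norm_mobProd_erase_apply_le (i k : ι) (x : H) :
    ‖mobProd hT lam (Finset.univ.erase i) x‖ ≤
      ‖mobProd hT lam (Finset.univ.erase k) x‖ + 2 * ‖blaschkeFun (lam i) (lam k)‖ * ‖x‖ := by
  rcases eq_or_ne i k with rfl | hik
  · have : 0 ≤ 2 * ‖blaschkeFun (lam i) (lam i)‖ * ‖x‖ := by positivity
    linarith
  set P := mobProd hT lam ((Finset.univ.erase i).erase k) with hP
  have hc : ∀ j, Commute (mob (lam j) T) P := fun j =>
    commute_mobProd hT lam (commute_mob hT (Commute.refl T) _).symm _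
  have h1 : mobProd hT lam (Finset.univ.erase i) = P * mob (lam k) T := by
    rw [← (hc k).eq, hP, ← mobProd_insert hT lam (Finset.notMem_erase _ _),
      Finset.insert_erase (by simp [hik.symm])]
  have h2 : mobProd hT lam (Finset.univ.erase k) = P * mob (lam i) T := by
    rw [← (hc i).eq, hP, Finset.erase_right_comm, ← mobProd_insert hT lam (Finset.notMem_erase _ _),
      Finset.insert_erase (by simp [hik])]
  obtain ⟨ω, hω, hle⟩ := exists_norm_mob_sub_smul_mob_le (lam i) (lam k) hT
  have h3 : mobProd hT lam (Finset.univ.erase i) x =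
      ω • mobProd hT lam (Finset.univ.erase k) x + P ((mob (lam k) T - ω • mob (lam i) T) x) := by
    rw [h1, h2]
    simp
  rw [h3]
  refine (norm_add_le _ _).trans ?_
  rw [norm_smul, hω, one_mul]
  gcongr
  calc _ ≤ 1 * ‖(mob (lam k) T - ω • mob (lam i) T) x‖ :=
        P.le_of_opNorm_le (norm_mobProd_le hT lam _) _
    _ ≤ _ := by
        rw [one_mul]
        exact ContinuousLinearMap.le_of_opNorm_le _ hle x

end Calculus

/-! ### Comparison of two cyclic operators annihilated by the same Blaschke product -/

section Similarity

lemma sum_le_of_forall_le_partial_sum {N : ℕ} {D s : ℝ} (hD : 0 ≤ D) (b : Fin N → ℝ)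
    (h : ∀ k, b k ≤ D * (s + ∑ i, if i < k then b i else 0)) :
    s + ∑ i, b i ≤ (1 + D) ^ N * s := by
  induction N with
  | zero => simp
  | succ n ih =>
    have h1 := ih (fun i => b i.castSucc) fun k => by
      simpa [Fin.sum_univ_castSucc, (Fin.castSucc_lt_last k).not_gt] using h k.castSucc
    have h2 := h (Fin.last n)
    simp only [Fin.sum_univ_castSucc, Fin.castSucc_lt_last, if_true, lt_irrefl, if_false,
      add_zero] at h2
    rw [Fin.sum_univ_castSucc, pow_succ']
    nlinarith

lemma finrank_le_of_cyclic {H : Type*} [NormedAddCommGroup H] [NormedSpace ℂ H] {T : H →L[ℂ] H}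
    {p : Polynomial ℂ} (hp : p.Monic) (hpT : Polynomial.aeval T p = 0) {x : H}
    (hx : (Submodule.span ℂ (Set.range fun n : ℕ => (T ^ n) x)).topologicalClosure = ⊤) :
    FiniteDimensional ℂ H ∧ Module.finrank ℂ H ≤ p.natDegree := by
  let f : Polynomial ℂ →ₗ[ℂ] H :=
    (ContinuousLinearMap.apply ℂ H x).toLinearMap ∘ₗ (Polynomial.aeval T).toLinearMap
  have hf : ∀ q, f q = Polynomial.aeval T q x := fun _ => rfl
  let e := Polynomial.degreeLTEquiv ℂ p.natDegree
  have : FiniteDimensional ℂ (Polynomial.degreeLT ℂ p.natDegree) := e.symm.finiteDimensional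
  set W := (Polynomial.degreeLT ℂ p.natDegree).map f with hW
  have hle : Submodule.span ℂ (Set.range fun n : ℕ => (T ^ n) x) ≤ W := by
    rw [Submodule.span_le]
    rintro _ ⟨n, rfl⟩
    refine ⟨Polynomial.X ^ n %ₘ p, ?_, ?_⟩
    · rw [SetLike.mem_coe, Polynomial.mem_degreeLT, ← Polynomial.degree_eq_natDegree hp.ne_zero]
      exact Polynomial.degree_modByMonic_lt _ hp
    · have h := congrArg (Polynomial.aeval T) (Polynomial.modByMonic_add_div (Polynomial.X ^ n) p)
      rw [map_add, map_mul, hpT, zero_mul, add_zero, map_pow, Polynomial.aeval_X] at h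
      rw [hf, h]
  have htop : W = ⊤ := by
    rw [eq_top_iff, ← hx]
    exact Submodule.topologicalClosure_minimal _ hle W.closed_of_finiteDimensional
  have hfin : FiniteDimensional ℂ H := by
    have : FiniteDimensional ℂ (⊤ : Submodule ℂ H) := htop ▸ inferInstance
    exact Module.finite_def.mpr (Module.Finite.iff_fg.mp this)
  refine ⟨hfin, ?_⟩
  calc Module.finrank ℂ H = Module.finrank ℂ W := by rw [htop, finrank_top]
    _ ≤ Module.finrank ℂ (Polynomial.degreeLT ℂ p.natDegree) := Submodule.finrank_map_le f _
    _ = p.natDegree := by rw [e.finrank_eq, Module.finrank_fin_fun]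

variable {H : Type*} [NormedAddCommGroup H] [InnerProductSpace ℂ H] [CompleteSpace H]
  {N : ℕ} (lam : Fin N → 𝔻) {T : H →L[ℂ] H} (hT : ‖T‖ ≤ 1)

lemma finrank_le_of_mobProd_eq_zero (h0 : mobProd hT lam Finset.univ = 0)
    (hc : IsMultiplicityFree T) : FiniteDimensional ℂ H ∧ Module.finrank ℂ H ≤ N := by
  obtain ⟨x, hx⟩ := hc
  obtain ⟨D, hD⟩ := exists_aeval_eq_mobProd_mul hT lam Finset.univ
  rw [h0, zero_mul] at hD
  simpa using finrank_le_of_cyclic (Polynomial.monic_prod_X_sub_C _ _) hD hx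

/-- The vector `b_{λ_1}(T) ⋯ b_{λ_n}(T) x`. -/
def newtonVec (x : H) (n : ℕ) : H := mobProd hT lam (Finset.univ.filter fun j => (j : ℕ) < n) x

lemma newtonVec_top (h0 : mobProd hT lam Finset.univ = 0) (x : H) : newtonVec lam hT x N = 0 := by
  simp [newtonVec, h0]

lemma newtonVec_succ (x : H) (k : Fin N) :
    newtonVec lam hT x (k + 1) = mob (lam k) T (newtonVec lam hT x k) := by
  have h : (Finset.univ.filter fun j : Fin N => (j : ℕ) < k + 1) =
      insert k (Finset.univ.filter fun j : Fin N => (j : ℕ) < k) := by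
    ext j
    simp [Fin.ext_iff]
    omega
  rw [newtonVec, h, mobProd_insert hT lam (by simp)]
  rfl

lemma apply_newtonVec (x : H) (k : Fin N) :
    T (newtonVec lam hT x k) = (lam k : ℂ) • newtonVec lam hT x k + newtonVec lam hT x (k + 1) -
      conj (lam k : ℂ) • T (newtonVec lam hT x (k + 1)) := by
  have h := congrArg (fun A => A (newtonVec lam hT x k)) (mobDen_mul_mob (lam k) hT)
  rw [mul_apply_eq_comp, ← newtonVec_succ] at h
  simp only [mobDen, sub_apply, smul_apply,
    one_apply_eq_self] at h
  rw [add_sub_assoc, h, add_sub_cancel]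

lemma norm_newtonVec_le {x : H} (hx : ‖x‖ ≤ 1) (n : ℕ) : ‖newtonVec lam hT x n‖ ≤ 1 := by
  refine ((mobProd hT lam _).le_of_opNorm_le (norm_mobProd_le hT lam _) x).trans ?_
  rwa [one_mul]

/-- The vectors `b_{λ_1}(T) ⋯ b_{λ_n}(T) x`, `0 ≤ n < N`, are linearly independent in a quantitative
sense as soon as no product of `N - 1` of the factors is small on `x`: the product of the factors
of index `> k` kills all vectors with `n > k`. -/
lemma sum_norm_le_norm_sum_newtonVec (h0 : mobProd hT lam Finset.univ = 0) {x : H} (hx : ‖x‖ ≤ 1)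
    {D : ℝ} (hD : 0 ≤ D) (h : ∀ i, 1 ≤ D * ‖mobProd hT lam (Finset.univ.erase i) x‖)
    (a : Fin N → ℂ) :
    ∑ i, ‖a i‖ ≤ (1 + D) ^ N * ‖∑ i, a i • newtonVec lam hT x i‖ := by
  set y := ∑ i, a i • newtonVec lam hT x i with hy
  have key := sum_le_of_forall_le_partial_sum (s := ‖y‖) hD (fun i => ‖a i‖) fun k => by
    set Q := mobProd hT lam (Finset.univ.filter fun j => k < j) with hQ
    have hQ1 : ‖Q‖ ≤ 1 := norm_mobProd_le hT lam _
    have hQn : ∀ z : H, ‖Q z‖ ≤ ‖z‖ := fun z => by simpa using Q.le_of_opNorm_le hQ1 z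
    have hgt : ∀ i, k < i → Q (newtonVec lam hT x i) = 0 := fun i hi => by
      rw [newtonVec, ← mul_apply_eq_comp, mobProd_mul_mobProd_eq_zero hT lam h0]
      · rfl
      · ext j
        simp
        omega
    have hkk : Q (newtonVec lam hT x k) = mobProd hT lam (Finset.univ.erase k) x := by
      rw [newtonVec, ← mul_apply_eq_comp, ← mobProd_union]
      · congr 2
        ext j
        simp
        omega
      · rw [Finset.disjoint_filter]
        intro j _ h1 h2
        omega
    have hsum : Q y = a k • Q (newtonVec lam hT x k) +
        ∑ i, if i < k then a i • Q (newtonVec lam hT x i) else 0 := by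
      rw [hy, map_sum, ← Finset.add_sum_erase _ _ (Finset.mem_univ k), map_smul]
      congr 1
      rw [← Finset.add_sum_erase (Finset.univ) (fun i => if i < k then _ else _)
        (Finset.mem_univ k), if_neg (lt_irrefl k), zero_add]
      refine Finset.sum_congr rfl fun i hi => ?_
      rw [map_smul]
      split_ifs with hik
      · rfl
      · rw [hgt i (lt_of_le_of_ne (not_lt.mp hik) (Finset.ne_of_mem_erase hi).symm), smul_zero]
    have h1 : ‖a k‖ * ‖mobProd hT lam (Finset.univ.erase k) x‖ ≤
        ‖y‖ + ∑ i, if i < k then ‖a i‖ else 0 := by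
      rw [← hkk, ← norm_smul, ← sub_eq_iff_eq_add.mpr hsum]
      refine (norm_sub_le _ _).trans (add_le_add (hQn y) ((norm_sum_le _ _).trans ?_))
      refine Finset.sum_le_sum fun i _ => ?_
      split_ifs
      · rw [norm_smul]
        exact mul_le_of_le_one_right (norm_nonneg _)
          ((hQn _).trans (norm_newtonVec_le lam hT hx _))
      · simp
    calc ‖a k‖ ≤ ‖a k‖ * (D * ‖mobProd hT lam (Finset.univ.erase k) x‖) :=
          le_mul_of_one_le_right (norm_nonneg _) (h k)
      _ = D * (‖a k‖ * ‖mobProd hT lam (Finset.univ.erase k) x‖) := by ring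
      _ ≤ _ := by gcongr
  exact (le_add_of_nonneg_left (norm_nonneg y)).trans key

lemma linearIndependent_newtonVec (h0 : mobProd hT lam Finset.univ = 0) {x : H} (hx : ‖x‖ ≤ 1)
    {D : ℝ} (hD : 0 ≤ D) (h : ∀ i, 1 ≤ D * ‖mobProd hT lam (Finset.univ.erase i) x‖) :
    LinearIndependent ℂ fun i : Fin N => newtonVec lam hT x i := by
  rw [Fintype.linearIndependent_iff]
  intro a ha i
  have h1 := sum_norm_le_norm_sum_newtonVec lam hT h0 hx hD h a
  rw [ha, norm_zero, mul_zero] at h1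
  have h2 := Finset.single_le_sum (f := fun i => ‖a i‖) (fun i _ => norm_nonneg _)
    (Finset.mem_univ i)
  exact norm_le_zero_iff.mp (h2.trans h1)

variable {K : Type*} [NormedAddCommGroup K] [InnerProductSpace ℂ K] [CompleteSpace K]
  {S : K →L[ℂ] K} (hS : ‖S‖ ≤ 1)

lemma norm_equiv_apply_le (h0 : mobProd hT lam Finset.univ = 0)
    {x : H} (hx : ‖x‖ ≤ 1) {D : ℝ} (hD : 0 ≤ D)
    (h : ∀ i, 1 ≤ D * ‖mobProd hT lam (Finset.univ.erase i) x‖) {y : K} (hy : ‖y‖ ≤ 1)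
    (b : Module.Basis (Fin N) ℂ H) (hb : ∀ i, b i = newtonVec lam hT x i) (X : H →ₗ[ℂ] K)
    (hX : ∀ i, X (b i) = newtonVec lam hS y i) (z : H) : ‖X z‖ ≤ (1 + D) ^ N * ‖z‖ := by
  have hz : z = ∑ i, b.repr z i • newtonVec lam hT x i := by
    simp_rw [← hb]
    exact (b.sum_repr z).symm
  have hXz : X z = ∑ i, b.repr z i • newtonVec lam hS y i := by
    conv_lhs => rw [← b.sum_repr z, map_sum]
    exact Finset.sum_congr rfl fun i _ => by rw [map_smul, hX]
  calc ‖X z‖ ≤ ∑ i, ‖b.repr z i‖ := by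
        rw [hXz]
        refine (norm_sum_le _ _).trans (Finset.sum_le_sum fun i _ => ?_)
        rw [norm_smul]
        exact mul_le_of_le_one_right (norm_nonneg _) (norm_newtonVec_le lam hS hy _)
    _ ≤ (1 + D) ^ N * ‖∑ i, b.repr z i • newtonVec lam hT x i‖ :=
        sum_norm_le_norm_sum_newtonVec lam hT h0 hx hD h _
    _ = _ := by rw [← hz]

/-- Two multiplicity-free contractions annihilated by the same Blaschke product of degree `N`
are similar by the operator matching `b_{λ_1}(T) ⋯ b_{λ_n}(T) x` with
`b_{λ_1}(S) ⋯ b_{λ_n}(S) y`. -/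
theorem exists_similarity (hN : N ≠ 0) (hTc : IsMultiplicityFree T) (hSc : IsMultiplicityFree S)
    (hT0 : mobProd hT lam Finset.univ = 0) (hS0 : mobProd hS lam Finset.univ = 0) {D : ℝ}
    (hD : 0 ≤ D) {x : H} (hx : ‖x‖ ≤ 1)
    (hxD : ∀ i, 1 ≤ D * ‖mobProd hT lam (Finset.univ.erase i) x‖) {y : K} (hy : ‖y‖ ≤ 1)
    (hyD : ∀ i, 1 ≤ D * ‖mobProd hS lam (Finset.univ.erase i) y‖) :
    ∃ X : H ≃L[ℂ] K, (∀ z, X (T z) = S (X z)) ∧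
      max ‖(X : H →L[ℂ] K)‖ ‖(X.symm : K →L[ℂ] H)‖ ≤ (1 + D) ^ N := by
  obtain ⟨hfT, hdT⟩ := finrank_le_of_mobProd_eq_zero lam hT hT0 hTc
  obtain ⟨hfS, hdS⟩ := finrank_le_of_mobProd_eq_zero lam hS hS0 hSc
  have liT := linearIndependent_newtonVec lam hT hT0 hx hD hxD
  have liS := linearIndependent_newtonVec lam hS hS0 hy hD hyD
  have : Nonempty (Fin N) := ⟨⟨0, Nat.pos_of_ne_zero hN⟩⟩
  let bT := basisOfLinearIndependentOfCardEqFinrank liT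
    (le_antisymm liT.fintype_card_le_finrank (by simpa using hdT))
  let bS := basisOfLinearIndependentOfCardEqFinrank liS
    (le_antisymm liS.fintype_card_le_finrank (by simpa using hdS))
  have hbT : ∀ i, bT i = newtonVec lam hT x i := fun i => by simp [bT]
  have hbS : ∀ i, bS i = newtonVec lam hS y i := fun i => by simp [bS]
  let L : H ≃ₗ[ℂ] K := bT.equiv bS (Equiv.refl _)
  have hL : ∀ i, L (bT i) = newtonVec lam hS y i := fun i => by simp [L, hbS]
  have hLs : ∀ i, L.symm (bS i) = newtonVec lam hT x i := fun i => by
    rw [LinearEquiv.symm_apply_eq, ← hbT, hL, hbS]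
  have hLn : ∀ n ≤ N, L (newtonVec lam hT x n) = newtonVec lam hS y n := fun n hn => by
    rcases hn.lt_or_eq with h | rfl
    · rw [← hL ⟨n, h⟩, hbT]
    · rw [newtonVec_top lam hT hT0, newtonVec_top lam hS hS0, map_zero]
  -- By `apply_newtonVec` the two operators act on the two bases by the same rule; the recursion
  -- runs downwards from the zero vector at `n = N`.
  have hint : ∀ d n, n + d = N → L (T (newtonVec lam hT x n)) = S (newtonVec lam hS y n) := by
    intro d
    induction d with
    | zero =>
      intro n hn
      obtain rfl : n = N := hn
      rw [newtonVec_top lam hT hT0, newtonVec_top lam hS hS0]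
      simp
    | succ d ih =>
      intro n hn
      have h1 := apply_newtonVec lam hT x ⟨n, by omega⟩
      have h2 := apply_newtonVec lam hS y ⟨n, by omega⟩
      rw [h1, h2]
      simp only [map_add, map_sub, map_smul]
      rw [ih (n + 1) (by omega), hLn n (by omega), hLn (n + 1) (by omega)]
  have hcomm : L.toLinearMap ∘ₗ T.toLinearMap = S.toLinearMap ∘ₗ L.toLinearMap := by
    refine bT.ext fun i => ?_
    have h := hint (N - i) i (by omega)
    rw [← hLn i i.2.le, ← hbT] at h
    exact h
  refine ⟨L.toContinuousLinearEquiv, fun z => LinearMap.congr_fun hcomm z, max_le ?_ ?_⟩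
  · exact ContinuousLinearMap.opNorm_le_bound _ (by positivity)
      (norm_equiv_apply_le lam hT hS hT0 hx hD hxD hy bT hbT L.toLinearMap hL)
  · exact ContinuousLinearMap.opNorm_le_bound _ (by positivity)
      (norm_equiv_apply_le lam hS hT hS0 hy hD hyD hx bS hbS L.symm.toLinearMap hLs)

end Similarity

/-! ### The model space of a finite Blaschke product -/

section Model

lemma norm_shift_le : ‖shift.toContinuousLinearMap‖ ≤ 1 := shift.norm_toContinuousLinearMap_le

lemma H2.eq_of_eval_eq {f g : H2} (h : ∀ z, f.eval z = g.eval z) : f = g := by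
  let p := FormalMultilinearSeries.ofScalars ℂ fun n => f n - g n
  have hr : (1 : ENNReal) ≤ p.radius := by
    refine p.le_radius_of_bound (r := 1) ‖f - g‖ fun n => ?_
    rw [FormalMultilinearSeries.ofScalars_norm, NNReal.coe_one, one_pow, mul_one]
    exact lp.norm_apply_le_norm two_ne_zero (f - g) n
  have hp := (p.hasFPowerSeriesOnBall (zero_lt_one.trans_le hr)).hasFPowerSeriesAt
  have h0 : p.sum =ᶠ[𝓝 0] 0 := by
    filter_upwards [Metric.isOpen_ball.mem_nhds (Metric.mem_ball_self (x := (0 : ℂ)) one_pos)]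
      with z hz
    have hz' : ‖z‖ < 1 := by simpa using hz
    have h1 := h (Complex.UnitDisc.mk z hz')
    have h2 := (f.summable (Complex.UnitDisc.mk z hz')).tsum_sub
      (g.summable (Complex.UnitDisc.mk z hz'))
    unfold H2.eval at h1
    rw [h1, sub_self] at h2
    refine (FormalMultilinearSeries.ofScalars_sum_eq _ z).trans ?_
    simpa [sub_mul] using h2
  have h3 := (FormalMultilinearSeries.ofScalars_series_eq_zero ℂ).mp (hp.congr h0).eq_zero
  ext n
  exact sub_eq_zero.mp (congrFun h3 n)

/-- The Szegő kernel `∑ conj a ^ n z ^ n` at the point `a`. -/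
def szego (a : 𝔻) : H2 :=
  ⟨fun n => conj (a : ℂ) ^ n, by
    refine (memℓp_gen_iff (by norm_num)).mpr ?_
    have h : Summable fun n : ℕ => (‖(a : ℂ)‖ ^ 2) ^ n :=
      summable_geometric_of_lt_one (by positivity)
        (by nlinarith [a.norm_lt_one, norm_nonneg (a : ℂ)])
    refine h.congr fun n => ?_
    simp
    ring⟩

lemma inner_szego (a : 𝔻) (f : H2) : inner ℂ (szego a) f = f.eval a := by
  rw [lp.inner_eq_tsum, H2.eval]
  refine tsum_congr fun n => ?_
  simp [szego]

lemma szego_ne_zero (a : 𝔻) : szego a ≠ 0 := fun h => by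
  have h1 : (szego a : H2) 0 = 0 := by rw [h]; rfl
  simp [szego] at h1

lemma eval_mob_shift (a : 𝔻) (f : H2) (z : 𝔻) :
    (mob a shift.toContinuousLinearMap f).eval z = (blaschke a).eval z * f.eval z := by
  set g := mob a shift.toContinuousLinearMap f with hg
  have h := congrArg (fun A => (A f).eval z) (mobDen_mul_mob a norm_shift_le)
  simp only [mul_apply_eq_comp, ← hg] at h
  have e : ∀ (c : ℂ) (u v : H2), (u - c • v).eval z = u.eval z - c * v.eval z := fun c u v => by
    rw [sub_eq_add_neg, ← neg_smul, H2.eval_add, H2.eval_smul]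
    ring
  have h1 : (g - conj (a : ℂ) • shift g).eval z = (shift f - (a : ℂ) • f).eval z := h
  rw [e, e, shift_eval, shift_eval] at h1
  change _ = ((z : ℂ) - a) / (1 - conj (a : ℂ) * z) * _
  rw [div_mul_eq_mul_div, eq_div_iff (one_sub_conj_mul_ne_zero a z)]
  linear_combination h1

variable {ι : Type*} [DecidableEq ι] (lam : ι → 𝔻)

lemma eval_mobProd_shift (s : Finset ι) (f : H2) (z : 𝔻) :
    (mobProd norm_shift_le lam s f).eval z = (∏ j ∈ s, blaschke (lam j)).eval z * f.eval z := by
  induction s using Finset.induction_on with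
  | empty => exact (one_mul _).symm
  | insert j s hj ih =>
    rw [mobProd_insert _ _ hj, mul_apply_eq_comp, eval_mob_shift, ih, Finset.prod_insert hj,
      ← mul_assoc]
    rfl

/-- The orthogonal projection of `H^2` onto the model space. -/
def modelProj (θ : HInf) : H2 →L[ℂ] ModelSpace θ :=
  ContinuousLinearMap.adjoint (mulRange θ)ᗮ.subtypeL

lemma modelProj_coe (θ : HInf) (f : ModelSpace θ) : modelProj θ (f : H2) = f := by
  refine ext_inner_right ℂ fun g => ?_
  rw [modelProj, ContinuousLinearMap.adjoint_inner_left]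
  rfl

lemma jordanBlock_modelProj (θ : HInf) (f : H2) :
    jordanBlock θ (modelProj θ f) = modelProj θ (shift f) := by
  refine ext_inner_right ℂ fun g => ?_
  rw [jordanBlock, ContinuousLinearMap.adjoint_inner_left, modelProj,
    ContinuousLinearMap.adjoint_inner_left, ContinuousLinearMap.adjoint_inner_left]
  change inner ℂ f (backShift g) = _
  rw [backShift, ContinuousLinearMap.adjoint_inner_right]
  rfl

lemma mob_jordanBlock_modelProj (θ : HInf) (a : 𝔻) (f : H2) :
    mob a (jordanBlock θ) (modelProj θ f) =
      modelProj θ (mob a shift.toContinuousLinearMap f) := by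
  obtain ⟨g, rfl⟩ := exists_mobDen_apply_eq a norm_shift_le f
  have h1 : modelProj θ (mobDen a shift.toContinuousLinearMap g) =
      mobDen a (jordanBlock θ) (modelProj θ g) := by
    change modelProj θ (g - conj (a : ℂ) • shift g) =
      modelProj θ g - conj (a : ℂ) • jordanBlock θ (modelProj θ g)
    rw [map_sub, map_smul, jordanBlock_modelProj]
  rw [h1, ← mul_apply_eq_comp, ← mul_apply_eq_comp, mob_mul_mobDen a (norm_jordanBlock_le θ),
    mob_mul_mobDen a norm_shift_le]
  change jordanBlock θ (modelProj θ g) - (a : ℂ) • modelProj θ g =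
    modelProj θ (shift g - (a : ℂ) • g)
  rw [map_sub, map_smul, jordanBlock_modelProj]

lemma mobProd_jordanBlock_modelProj (θ : HInf) (s : Finset ι) (f : H2) :
    mobProd (norm_jordanBlock_le θ) lam s (modelProj θ f) =
      modelProj θ (mobProd norm_shift_le lam s f) := by
  induction s using Finset.induction_on with
  | empty => rfl
  | insert j s hj ih =>
    rw [mobProd_insert _ _ hj, mobProd_insert _ _ hj, mul_apply_eq_comp, mul_apply_eq_comp, ih,
      mob_jordanBlock_modelProj]

/-- The projection of the constant function `1` is a cyclic vector. -/
lemma isMultiplicityFree_jordanBlock (θ : HInf) : IsMultiplicityFree (jordanBlock θ) := by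
  have hpow : ∀ n : ℕ, ((jordanBlock θ) ^ n) (modelProj θ (lp.single 2 0 1)) =
      modelProj θ (lp.single 2 n 1) := by
    intro n
    induction n with
    | zero => rfl
    | succ n ih =>
      rw [pow_succ', mul_apply_eq_comp, ih, jordanBlock_modelProj]
      congr 1
      ext m
      rcases m with _ | m
      · simp [shift, shiftSeq]
      · change (lp.single 2 n (1 : ℂ) : H2) m = _
        simp [lp.single_apply, Pi.single_apply]
  refine ⟨modelProj θ (lp.single 2 0 1), Submodule.topologicalClosure_eq_top_iff.mpr ?_⟩
  rw [eq_bot_iff]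
  intro f hf
  rw [Submodule.mem_bot]
  ext n
  have h := (Submodule.mem_orthogonal _ f).mp hf _ (Submodule.subset_span ⟨n, rfl⟩)
  beta_reduce at h
  rw [hpow, modelProj, ContinuousLinearMap.adjoint_inner_left] at h
  have h1 := lp.inner_single_left (𝕜 := ℂ) n (1 : ℂ) (f : H2)
  have h2 : inner ℂ (1 : ℂ) ((f : H2) n) = 0 := h1.symm.trans h
  simpa using h2

/-- With one factor removed, a finite Blaschke product still has norm at least one on its model
space: it acts isometrically on the Szegő kernel at the removed point. -/
lemma one_le_norm_mobProd_jordanBlock [Fintype ι] {θ : HInf}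
    (hθ : θ = ∏ j, blaschke (lam j)) (i : ι) :
    1 ≤ ‖mobProd (norm_jordanBlock_le θ) lam (Finset.univ.erase i)‖ := by
  set W := mobProd norm_shift_le lam (Finset.univ.erase i) with hW
  set k := szego (lam i) with hk
  have hiso : ∀ f, ‖W f‖ = ‖f‖ := norm_mobProd_apply_of_isometry norm_shift_le lam shift.norm_map _
  have hzero : (blaschke (lam i)).eval (lam i) = 0 := by
    change ((lam i : ℂ) - lam i) / _ = 0
    rw [sub_self, zero_div]
  have hfac : ∀ z, θ.eval z =
      (∏ j ∈ Finset.univ.erase i, blaschke (lam j)).eval z * (blaschke (lam i)).eval z :=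
    fun z => by
      rw [hθ, ← Finset.prod_erase_mul _ _ (Finset.mem_univ i)]
      rfl
  have hkm : k ∈ (mulRange θ)ᗮ := by
    rw [Submodule.mem_orthogonal']
    rintro f ⟨g, hg⟩
    rw [hk, inner_szego, hg, hfac, hzero, mul_zero, zero_mul]
  have hWkm : W k ∈ (mulRange θ)ᗮ := by
    rw [Submodule.mem_orthogonal']
    rintro f ⟨g, hg⟩
    have hf : f = W (mob (lam i) shift.toContinuousLinearMap g) := H2.eq_of_eval_eq fun z => by
      rw [hW, eval_mobProd_shift, eval_mob_shift, hg, hfac, mul_assoc]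
    let Wi : H2 →ₗᵢ[ℂ] H2 := ⟨W.toLinearMap, hiso⟩
    have h1 : inner ℂ (W k) (W (mob (lam i) shift.toContinuousLinearMap g)) =
        inner ℂ k (mob (lam i) shift.toContinuousLinearMap g) := Wi.inner_map_map _ _
    rw [hf, h1, hk, inner_szego, eval_mob_shift, hzero, zero_mul]
  have h : mobProd (norm_jordanBlock_le θ) lam (Finset.univ.erase i) ⟨k, hkm⟩ = ⟨W k, hWkm⟩ := by
    have h1 := mobProd_jordanBlock_modelProj lam θ (Finset.univ.erase i) k
    rwa [modelProj_coe θ ⟨k, hkm⟩, ← hW, modelProj_coe θ ⟨W k, hWkm⟩] at h1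
  have h2 := (mobProd (norm_jordanBlock_le θ) lam (Finset.univ.erase i)).le_opNorm ⟨k, hkm⟩
  rw [h] at h2
  have h3 : ‖k‖ ≤ _ * ‖k‖ := (hiso k).symm.le.trans h2
  exact le_of_mul_le_mul_right (by rwa [one_mul]) (norm_pos_iff.mpr (szego_ne_zero _))

end Model

/-! ### The similarity -/

section Main

lemma norm_blaschkeFun_le_eta_sq {N : ℕ} (lam : Fin N → 𝔻) (i j : Fin N) :
    ‖blaschkeFun (lam i) (lam j)‖ ≤ eta lam ^ 2 := by
  set m := max ‖(lam i : ℂ)‖ ‖(lam j : ℂ)‖ with hm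
  have hm0 : 0 ≤ m := (norm_nonneg _).trans (le_max_left _ _)
  have hm1 : m < 1 := max_lt (lam i).norm_lt_one (lam j).norm_lt_one
  have h1 : Real.sqrt ‖blaschkeFun (lam i) (lam j)‖ / Real.sqrt (1 - m ^ 2) ≤ eta lam :=
    le_ciSup (f := fun p : Fin N × Fin N => Real.sqrt ‖blaschkeFun (lam p.1) (lam p.2)‖ /
      Real.sqrt (1 - max ‖(lam p.1 : ℂ)‖ ‖(lam p.2 : ℂ)‖ ^ 2)) (Set.finite_range _).bddAbove (i, j)
  have h2 : 0 < Real.sqrt (1 - m ^ 2) := Real.sqrt_pos.mpr (by nlinarith)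
  have h3 : Real.sqrt (1 - m ^ 2) ≤ 1 := Real.sqrt_le_one.mpr (by nlinarith)
  have h4 := (le_div_self (Real.sqrt_nonneg ‖blaschkeFun (lam i) (lam j)‖) h2 h3).trans h1
  exact (Real.sqrt_le_left ((Real.sqrt_nonneg _).trans h4)).mp h4

lemma norm_blaschkeFun_le_of_eta_le {N : ℕ} (lam : Fin N → 𝔻) {M : ℝ}
    (h : 5 * √2 * eta lam ≤ 1 / M) (i j : Fin N) :
    ‖blaschkeFun (lam i) (lam j)‖ ≤ 1 / (50 * M ^ 2) := by
  have hη0 : 0 ≤ eta lam := Real.iSup_nonneg fun p => by positivity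
  have h2 := pow_le_pow_left₀ (by positivity) h 2
  rw [mul_pow, mul_pow, Real.sq_sqrt (by norm_num), div_pow, one_pow] at h2
  have h3 : 1 / (50 * M ^ 2) = 1 / M ^ 2 / 50 := by rw [div_div, mul_comm]
  rw [h3]
  linarith [norm_blaschkeFun_le_eta_sq lam i j]

/-- A vector on which the product without its first factor is not small serves for the products
without any other factor too, since the `λ_j` are close to each other. -/
lemma exists_vector {H : Type*} [NormedAddCommGroup H] [InnerProductSpace ℂ H] [CompleteSpace H]
    {T : H →L[ℂ] H} (hT : ‖T‖ ≤ 1) {N : ℕ} (lam : Fin N → 𝔻) {M : ℝ} (hM : 1 ≤ M) (i₀ : Fin N)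
    (hlam : ∀ i, ‖blaschkeFun (lam i₀) (lam i)‖ ≤ 1 / (50 * M ^ 2))
    (h : 1 / M ≤ ‖mobProd hT lam (Finset.univ.erase i₀)‖) :
    ∃ x : H, ‖x‖ ≤ 1 ∧ ∀ i, 1 ≤ 4 * M * ‖mobProd hT lam (Finset.univ.erase i) x‖ := by
  have hM0 : 0 < M := one_pos.trans_le hM
  -- The norm need not be attained, so half of it is given away.
  obtain ⟨x, hx, hxM⟩ := ContinuousLinearMap.exists_lt_apply_of_lt_opNorm
    (mobProd hT lam (Finset.univ.erase i₀)) (r := 1 / (2 * M))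
    (lt_of_lt_of_le (one_div_lt_one_div_of_lt hM0 (by linarith)) h)
  refine ⟨x, hx.le, fun i => ?_⟩
  have h1 := norm_mobProd_erase_apply_le hT lam i₀ i x
  have h2 : 2 * ‖blaschkeFun (lam i₀) (lam i)‖ * ‖x‖ ≤ 2 * (1 / (50 * M ^ 2)) * 1 := by
    gcongr
    exact hlam i
  have h3 : M * (1 / (2 * M)) = 1 / 2 := by field_simp
  have h4 : M * (2 * (1 / (50 * M ^ 2)) * 1) ≤ 1 / 4 := by
    have : M * (2 * (1 / (50 * M ^ 2)) * 1) = 1 / (25 * M) := by field_simp; norm_num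
    rw [this]
    exact one_div_le_one_div_of_le (by norm_num) (by linarith)
  nlinarith [mul_le_mul_of_nonneg_left (hxM.le.trans (h1.trans (add_le_add_right h2 _))) hM0.le]

end Main

end

end CZero

theorem corollary3p6 :
    ∃ C : ℝ → ℕ → ℝ, (∀ M N, 0 < C M N) ∧
      ∀ (H : Type*) [NormedAddCommGroup H] [InnerProductSpace ℂ H] [CompleteSpace H]
        (N : ℕ) (lam : Fin N → 𝔻) (θ : CZero.HInf) (T : H →L[ℂ] H) (hT : ‖T‖ ≤ 1)
        (Ψ : CZero.HInfAlg T hT →L[ℂ]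
          CZero.HInfAlg (CZero.jordanBlock θ) (CZero.norm_jordanBlock_le θ))
        (β : ℝ),
        2 ≤ N →
        θ = CZero.blaschkeProd lam →
        CZero.IsClassC0 T →
        CZero.IsMultiplicityFree T →
        CZero.IsMinimalFunction T θ →
        (∀ (u : CZero.HInf) (A : CZero.HInfAlg T hT),
          CZero.HasCalculus T u A → CZero.HasCalculus (CZero.jordanBlock θ) u (Ψ A)) →
        β = 1 / ‖Ψ‖ - 5 * √2 * CZero.eta lam →
        √(1 - 1 / ((N : ℝ) - 1) ^ 2) < β →
        β < 1 →
        ∃ X : H ≃L[ℂ] CZero.ModelSpace θ,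
          (∀ x : H, X (T x) = CZero.jordanBlock θ (X x)) ∧
          max ‖(X : H →L[ℂ] CZero.ModelSpace θ)‖ ‖(X.symm : CZero.ModelSpace θ →L[ℂ] H)‖
            ≤ C ‖Ψ‖ N := by
  -- The absolute value only serves to make the constant positive for negative `M`.
  refine ⟨fun M N => (1 + 4 * |M|) ^ N, fun M N => by positivity, ?_⟩
  intro H _ _ _ N lam θ T hT Ψ β hN hθ _ hTc hmin hΨ hβ hβ0 _
  beta_reduce
  rw [abs_of_nonneg Ψ.opNorm_nonneg]
  have hS := CZero.norm_jordanBlock_le θ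
  have hT0 : CZero.mobProd hT lam Finset.univ = 0 := by
    have h := CZero.hasCalculus_mobProd hT lam Finset.univ
    rw [← CZero.blaschkeProd, ← hθ] at h
    exact h.unique ((hmin.2 θ).mpr dvd_rfl)
  have hΨm : ∀ s, ((Ψ ⟨CZero.mobProd hT lam s, _, CZero.hasCalculus_mobProd hT lam s⟩ :
      CZero.HInfAlg _ hS) : CZero.ModelSpace θ →L[ℂ] CZero.ModelSpace θ) =
      CZero.mobProd hS lam s := fun s =>
    (hΨ _ ⟨CZero.mobProd hT lam s, _, CZero.hasCalculus_mobProd hT lam s⟩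
      (CZero.hasCalculus_mobProd hT lam s)).unique (CZero.hasCalculus_mobProd hS lam s)
  have hS0 : CZero.mobProd hS lam Finset.univ = 0 := by
    rw [← hΨm]
    have h : (⟨CZero.mobProd hT lam Finset.univ, _, CZero.hasCalculus_mobProd hT lam _⟩ :
        CZero.HInfAlg T hT) = 0 := Subtype.ext hT0
    rw [h, Ψ.map_zero]
    rfl
  let i₀ : Fin N := ⟨0, by omega⟩
  have hnS := CZero.one_le_norm_mobProd_jordanBlock lam hθ i₀
  have hΨn : 1 ≤ ‖Ψ‖ * ‖CZero.mobProd hT lam (Finset.univ.erase i₀)‖ := by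
    refine hnS.trans ?_
    rw [← hΨm]
    exact Ψ.le_opNorm _
  have hM : 1 ≤ ‖Ψ‖ := hΨn.trans
    (mul_le_of_le_one_right Ψ.opNorm_nonneg (CZero.norm_mobProd_le hT lam _))
  generalize ‖Ψ‖ = M at *
  have hM0 : 0 < M := one_pos.trans_le hM
  have hnT : 1 / M ≤ ‖CZero.mobProd hT lam (Finset.univ.erase i₀)‖ := by
    rwa [div_le_iff₀' hM0]
  have hlam := CZero.norm_blaschkeFun_le_of_eta_le lam (M := M)
    (by linarith [Real.sqrt_nonneg (1 - 1 / ((N : ℝ) - 1) ^ 2)]) i₀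
  obtain ⟨x, hx, hxD⟩ := CZero.exists_vector hT lam hM i₀ hlam hnT
  obtain ⟨y, hy, hyD⟩ := CZero.exists_vector hS lam hM i₀ hlam
    (((div_le_one hM0).mpr hM).trans hnS)
  exact CZero.exists_similarity lam hT hS (by omega) hTc (CZero.isMultiplicityFree_jordanBlock θ)
    hT0 hS0 (by positivity) hx hxD hy hyD
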